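/- Let $E$ be a complex Banach space, let $A$ be a (closed, not necessarily bounded or densely defined) linear operator in $E$ with resolvent set $\rho(A)$ and resolvent $R(\mu:A)=(\mu-A)^{-1}$, let $K\in L^1_{loc}([0,\infty))$ be complex-valued, and put $\Theta(t)=\int_0^t K(s)\,ds$. For $0<\tau\le\infty$, a $K$-convoluted cosine function on $[0,\tau)$ is a strongly continuous family $(C_K(t))_{t\in[0,\tau)}$ of bounded operators on $E$ for which there is a closed operator $B$ (a subgenerator) such that $C_K(t)B\subset BC_K(t)$, $\int_0^t(t-s)C_K(s)x\,ds\in D(B)$ and $B\int_0^t(t-s)C_K(s)x\,ds=C_K(t)x-\Theta(t)x$ for all $t\in[0,\tau)$, $x\in E$. Its generator is the operator with graph $\{(x,y)\in E^2: C_K(t)x-\Theta(t)x=\int_0^t(t-s)C_K(s)y\,ds \text{ for all } t\in[0,\tau)\}$. For $f\in L^1_{loc}([0,\infty))$ let $\tilde f(\lambda)=\lim_{T\to\infty}\int_0^T e^{-\lambda t}f(t)\,dt$ where the limit exists, and let $\mathrm{abs}(f)$ be the infimum of $\mathrm{Re}\,\lambda$ over all $\lambda$ for which it exists. We say that $f$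 satisfies (P2) if $\tilde f(\lambda)$ exists on some half plane $\mathrm{Re}\,\lambda>b_0$, and for some real $b\ge \mathrm{abs}(f)$ one has $\tilde f(\lambda)\ne0$ whenever $\mathrm{Re}\,\lambda>b$. For $\varepsilon,c>0$ let $\Omega_{\varepsilon,c}=\{\lambda\in\mathbb C:\mathrm{Re}\,\lambda\ge\varepsilon|\lambda|+c\}$ and $\Omega^2_{\varepsilon,c}=\{\lambda^2:\lambda\in\Omega_{\varepsilon,c}\}$. (a) Let $0<\tau<\infty$, let $\Theta$ satisfy (P2) and $|\Theta(t)|\le Me^{\beta t}$, $t\ge0$, for some $M,\beta>0$, and let $A$ be the generator of a $K$-convoluted cosine function on $[0,\tau)$. Suppose that for every $\varepsilon>0$ there exist $C_\varepsilon>0$, $T_\varepsilon>0$ and $\varepsilon_0\in(0,\tau\varepsilon)$ such that $$\frac1{|\tilde\Theta(\lambda)|}\le T_\varepsilon e^{\varepsilon_0|\lambda|},\qquad \lambda\in\Omega_{\varepsilon,C_\varepsilon},\ \mathrm{Re}\,\lambda>\beta.$$ Then for every $\varepsilon>0$ there exist $\overline C_\varepsilon>0$ and $\overline K_\varepsilon>0$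 such that $$\Omega^2_{\varepsilon,\overline C_\varepsilon}\subset\rho(A)\quad\text{and}\quad\|R(\lambda^2:A)\|\le\overline K_\varepsilon e^{\tau\varepsilon|\lambda|},\quad\lambda\in\Omega_{\varepsilon,\overline C_\varepsilon}.$$ (b) Let $(M_p)_{p\ge0}$ be a sequence of positive numbers with $M_0=1$ such that $M_p^2\le M_{p+1}M_{p-1}$ for $p\ge1$; $M_{p+q}\le aH^{p+q}M_pM_q$ for all $p,q$ and some $a,H>0$; and $\sum_{p\ge1}M_{p-1}/M_p<\infty$. Put $M(\rho)=\sup_{p\ge0}\ln(\rho^p/M_p)$ for $\rho>0$, $M(0)=0$, $M(\lambda)=M(|\lambda|)$ for $\lambda\in\mathbb C$, and for $\alpha,\beta,\gamma>0$ let $\Lambda_{\alpha,\beta,\gamma}=\{\lambda\in\mathbb C:\mathrm{Re}\,\lambda\ge M(\alpha\lambda)/\gamma+\beta\}$ and $\Lambda^2_{\alpha,\beta,\gamma}=\{\lambda^2:\lambda\in\Lambda_{\alpha,\beta,\gamma}\}$. Let $0<\tau\le\infty$, let $|\Theta(t)|\le M_0'e^{\beta_0 t}$, $t\ge0$, for some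 $M_0',\beta_0>0$, let $K$ satisfy (P2), let $K$ not vanish almost everywhere on $[0,\tau)$, and let $A$ be the generator of a $K$-convoluted cosine function on $[0,\tau)$. If there is an $\alpha>0$ with $$\frac1{|\tilde\Theta(\lambda)|}=O\big(e^{M(\alpha\lambda)}\big),\qquad|\lambda|\to\infty,\ \mathrm{Re}\,\lambda>\beta_0,$$ then for every $\tau_1\in(0,\tau)$ there exist $\beta>0$ and $C>0$ such that $$\Lambda^2_{\alpha,\beta,\tau_1}\subset\rho(A)\quad\text{and}\quad\|R(\lambda:A)\|\le C\,\frac{e^{M(\alpha\sqrt\lambda)}}{1+\sqrt{|\lambda|}},\quad\lambda\in\Lambda^2_{\alpha,\beta,\tau_1}.$$ -/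

import Mathlib

open Set Filter Topology MeasureTheory

noncomputable section

namespace ConvCosine

/-! ### Scalar functions on the half line and their Laplace transforms -/

/-- The function `Θ(t) = ∫₀ᵗ K(s) ds`. -/
def primitive (K : ℝ → ℂ) (t : ℝ) : ℂ := ∫ s in (0 : ℝ)..t, K s

/-- The truncated Laplace integral `∫₀ᵀ e^{-λt} f(t) dt`. -/
def laplaceTrunc (f : ℝ → ℂ) (z : ℂ) (T : ℝ) : ℂ :=
  ∫ t in (0 : ℝ)..T, Complex.exp (-(z * (t : ℂ))) * f t

/-- The (improper) Laplace integral of `f` at `z` exists. -/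
def LaplaceExists (f : ℝ → ℂ) (z : ℂ) : Prop :=
  ∃ L : ℂ, Tendsto (laplaceTrunc f z) atTop (𝓝 L)

/-- The Laplace transform, as an improper integral (meaningful where `LaplaceExists f z`). -/
def laplace (f : ℝ → ℂ) (z : ℂ) : ℂ := limUnder atTop (laplaceTrunc f z)

/-- The abscissa of convergence `inf {Re z : the Laplace integral exists at z}`, which may be
infinite. -/
def abscissa (f : ℝ → ℂ) : EReal :=
  sInf ((fun z : ℂ => ((z.re : ℝ) : EReal)) '' {z | LaplaceExists f z})

/-- `f ∈ L¹_loc([0,∞))` is Laplace transformable. -/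
def CondP1 (f : ℝ → ℂ) : Prop :=
  LocallyIntegrableOn f (Ici 0) ∧ ∃ b : ℝ, ∀ z : ℂ, b < z.re → LaplaceExists f z

/-- `f` is Laplace transformable and its transform has no zero in some half plane
`Re z > b` with `b ≥ abs(f)`. -/
def CondP2 (f : ℝ → ℂ) : Prop :=
  CondP1 f ∧ ∃ b : ℝ, abscissa f ≤ (b : EReal) ∧ ∀ z : ℂ, b < z.re → laplace f z ≠ 0

/-! ### Weight sequences and regions in the complex plane -/

/-- A sequence of positive numbers with `M₀ = 1` satisfying (M.1), (M.2) and (M.3)'. -/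
structure IsWeightSeq (m : ℕ → ℝ) : Prop where
  pos : ∀ p, 0 < m p
  zero : m 0 = 1
  m1 : ∀ p, m (p + 1) ^ 2 ≤ m (p + 2) * m p
  m2 : ∃ a H : ℝ, 0 < a ∧ 0 < H ∧ ∀ p q, m (p + q) ≤ a * H ^ (p + q) * (m p * m q)
  m3 : Summable fun p => m p / m (p + 1)

/-- The associated function `M(ρ) = sup_{p ≥ 0} ln (ρᵖ / M_p)` for `ρ > 0`, and `M(0) = 0`. -/
def assocFun (m : ℕ → ℝ) (r : ℝ) : ℝ :=
  if r = 0 then 0 else ⨆ p : ℕ, Real.log (r ^ p / m p)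

/-- The Ōuchi region `{λ : Re λ ≥ ε|λ| + c}`. -/
def ouchi (ε c : ℝ) : Set ℂ := {z | ε * ‖z‖ + c ≤ z.re}

/-- The ultra-logarithmic region `{λ : Re λ ≥ M(α|λ|)/γ + β}`. -/
def ultraLog (m : ℕ → ℝ) (α β γ : ℝ) : Set ℂ :=
  {z | assocFun m (α * ‖z‖) / γ + β ≤ z.re}

/-- The set of squares `{λ² : λ ∈ S}`. -/
def squares (S : Set ℂ) : Set ℂ := (fun z : ℂ => z ^ 2) '' S

variable {E : Type*} [NormedAddCommGroup E] [NormedSpace ℂ E]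

/-! ### Resolvents of unbounded operators -/

/-- `R` is a bounded two-sided inverse of `z - A : D(A) → E`. -/
def IsResolventAt (A : E →ₗ.[ℂ] E) (z : ℂ) (R : E →L[ℂ] E) : Prop :=
  (∀ x : E, ∃ h : R x ∈ A.domain, z • R x - A ⟨R x, h⟩ = x) ∧
    ∀ x : A.domain, R (z • (x : E) - A x) = x

/-- The resolvent set `ρ(A)`. -/
def resolventSet (A : E →ₗ.[ℂ] E) : Set ℂ := {z | ∃ R : E →L[ℂ] E, IsResolventAt A z R}

open Classical in
/-- The resolvent `R(z : A) = (z - A)⁻¹` for `z ∈ ρ(A)` (and `0` otherwise). -/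
def resolvent (A : E →ₗ.[ℂ] E) (z : ℂ) : E →L[ℂ] E :=
  if h : z ∈ resolventSet A then Classical.choose h else 0

/-! ### Convoluted cosine functions -/

/-- The interval `[0,τ)`, `0 < τ ≤ ∞`. -/
def timeInterval (τ : EReal) : Set ℝ := {t | 0 ≤ t ∧ (t : EReal) < τ}

/-- The closed operator `A` is a subgenerator of the `K`-convoluted cosine function
`(C t)`, `t ∈ [0,τ)`. -/
structure IsSubgenerator (A : E →ₗ.[ℂ] E) (K : ℝ → ℂ) (τ : EReal)
    (C : ℝ → E →L[ℂ] E) : Prop where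
  closed : A.IsClosed
  strongCont : ∀ x : E, ContinuousOn (fun t => C t x) (timeInterval τ)
  comm : ∀ t ∈ timeInterval τ, ∀ x : A.domain,
    ∃ h : C t x ∈ A.domain, A ⟨C t x, h⟩ = C t (A x)
  integral : ∀ t ∈ timeInterval τ, ∀ x : E,
    ∃ h : (∫ s in (0 : ℝ)..t, ((t - s : ℝ) : ℂ) • C s x) ∈ A.domain,
      A ⟨∫ s in (0 : ℝ)..t, ((t - s : ℝ) : ℂ) • C s x, h⟩ = C t x - primitive K t • x

/-- `(C t)`, `t ∈ [0,τ)`, is a `K`-convoluted cosine function: it has a subgenerator. -/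
def IsConvolutedCosine (K : ℝ → ℂ) (τ : EReal) (C : ℝ → E →L[ℂ] E) : Prop :=
  ∃ B : E →ₗ.[ℂ] E, IsSubgenerator B K τ C

/-- `A` is the (integral) generator of the `K`-convoluted cosine function `(C t)`,
`t ∈ [0,τ)`: its graph is
`{(x,y) : C(t)x - Θ(t)x = ∫₀ᵗ (t-s) C(s)y ds for all t ∈ [0,τ)}`. -/
def IsGenerator (A : E →ₗ.[ℂ] E) (K : ℝ → ℂ) (τ : EReal) (C : ℝ → E →L[ℂ] E) : Prop :=
  IsConvolutedCosine K τ C ∧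
    ∀ x y : E, (x, y) ∈ A.graph ↔
      ∀ t ∈ timeInterval τ,
        C t x - primitive K t • x = ∫ s in (0 : ℝ)..t, ((t - s : ℝ) : ℂ) • C s y

end ConvCosine

end

namespace ConvCosine

variable {E : Type*} [NormedAddCommGroup E] [NormedSpace ℂ E]

/-! ### Resolvents -/

/-! Fix `t < τ`, let `U s` be the second primitive of the cosine function, and truncate the Laplace
formula for the resolvent: `V x = ∫₀ᵗ e^{-zs} U(s)x ds`. Closedness of the subgenerator gives `A V x
= ∫₀ᵗ e^{-zs} (C s x - Θ(s)x) ds`, and two integrations by parts turn this into `(z² - A) V = θ_t -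
D`, where `θ_t` is the truncated transform of `Θ` and `D` is a boundary term at `t` of size `(1 +
|z|) e^{-t Re z}`. Replacing `θ_t` by the full transform `θ` costs another `O(e^{-t Re z})`. Hence
`(z² - A) V = θ (1 - D')`, and a Neumann series inverts `1 - D'` once `(1 + |z|) e^{-t Re z} / |θ|`
is small. Injectivity of `z² - A` comes from the same computation on an eigenvector, via the
integral description of the generator.

This is `exists_approx_resolvent` followed by `exists_resolvent_sq_bound`. Both regions are shaped
so that `e^{-t Re z}` beats `1/|θ|` with an exponent to spare when `t` is close enough to `τ`; the
spare exponent absorbs `1 + |z|`, and moving the region to the right supplies the smallness. -/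

theorem isResolventAt_unique {A : E →ₗ.[ℂ] E} {z : ℂ} {R S : E →L[ℂ] E}
    (hR : IsResolventAt A z R) (hS : IsResolventAt A z S) : R = S := by
  ext x
  obtain ⟨h, hx⟩ := hS.1 x
  have := hR.2 ⟨S x, h⟩
  rwa [hx] at this

theorem resolvent_eq {A : E →ₗ.[ℂ] E} {z : ℂ} {R : E →L[ℂ] E} (hR : IsResolventAt A z R) :
    resolvent A z = R := by
  have h : z ∈ resolventSet A := ⟨R, hR⟩
  rw [resolvent, dif_pos h]
  exact isResolventAt_unique h.choose_spec hR

/-- An approximate right inverse of `z - A`, with `z - A` injective, yields the resolvent. -/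
theorem exists_isResolventAt_of_approx [CompleteSpace E] {A : E →ₗ.[ℂ] E} {z θ : ℂ}
    {V D : E →L[ℂ] E}
    (hθ : θ ≠ 0) (hD : ‖D‖ ≤ 1 / 2)
    (hV : ∀ x, (V x, z • V x - θ • (x - D x)) ∈ A.graph)
    (hinj : ∀ x, (x, z • x) ∈ A.graph → x = D x) :
    ∃ R, IsResolventAt A z R ∧ ‖R‖ ≤ 2 * ‖V‖ / ‖θ‖ := by
  have hker : ∀ x, x = D x → x = 0 := fun x hx => by
    have h1 : ‖x‖ ≤ 1 / 2 * ‖x‖ := by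
      calc ‖x‖ = ‖D x‖ := by rw [← hx]
        _ ≤ 1 / 2 * ‖x‖ := D.le_of_opNorm_le hD x
    have := norm_nonneg x
    exact norm_eq_zero.1 (by linarith)
  obtain ⟨u, hu⟩ := isUnit_one_sub_of_norm_lt_one (x := D) (by linarith)
  set J : E →L[ℂ] E := ↑u⁻¹
  have hJ : ∀ x, J x - D (J x) = x := fun x => by
    have : (1 - D) * J = 1 := by rw [← hu]; exact u.mul_inv
    simpa using congrArg (fun T : E →L[ℂ] E => T x) this
  have hJn : ∀ x, ‖J x‖ ≤ 2 * ‖x‖ := fun x => by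
    have h1 : ‖J x‖ ≤ ‖x‖ + 1 / 2 * ‖J x‖ := by
      calc ‖J x‖ = ‖x + D (J x)‖ := by rw [← sub_eq_iff_eq_add.1 (hJ x)]
        _ ≤ ‖x‖ + ‖D (J x)‖ := norm_add_le _ _
        _ ≤ _ := by gcongr; exact D.le_of_opNorm_le hD _
    linarith
  -- `hV` says `(z - A) V = θ (1 - D)`, so `θ⁻¹ V (1 - D)⁻¹` is an exact right inverse.
  have hright : ∀ x, ((θ⁻¹ • (V ∘L J)) x, z • (θ⁻¹ • (V ∘L J)) x - x) ∈ A.graph := fun x => by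
    have h1 := A.graph.smul_mem θ⁻¹ (hV (J x))
    rw [hJ, Prod.smul_mk, smul_sub, smul_comm _ z, inv_smul_smul₀ hθ] at h1
    exact h1
  have hres : ∀ x, ∃ h : (θ⁻¹ • (V ∘L J)) x ∈ A.domain,
      z • (θ⁻¹ • (V ∘L J)) x - A ⟨(θ⁻¹ • (V ∘L J)) x, h⟩ = x := fun x => by
    obtain ⟨y, hy1, hy2⟩ := A.mem_graph_iff.1 (hright x)
    have hd : (θ⁻¹ • (V ∘L J)) x ∈ A.domain := by
      have h2 := y.2
      rw [hy1] at h2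
      exact h2
    refine ⟨hd, ?_⟩
    have : (⟨_, hd⟩ : A.domain) = y := Subtype.ext hy1.symm
    rw [this, hy2, sub_sub_cancel]
  refine ⟨θ⁻¹ • (V ∘L J), ⟨hres, fun x => ?_⟩, ?_⟩
  -- The difference `R w - x` satisfies `A y = z y`, hence is fixed by `D` and vanishes; no
  -- commutation of `V` with `A` is needed.
  · set w := z • (x : E) - A x with hw
    have h1 := A.graph.sub_mem (hright w) (A.mem_graph x)
    rw [← sub_eq_zero]
    refine hker _ (hinj _ ?_)
    convert h1 using 1
    simp only [Prod.mk_sub_mk, Prod.mk.injEq, true_and, smul_sub]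
    rw [hw]; abel
  · refine ContinuousLinearMap.opNorm_le_bound _ (by positivity) fun x => ?_
    calc ‖(θ⁻¹ • (V ∘L J)) x‖ = ‖θ‖⁻¹ * ‖V (J x)‖ := by simp [norm_smul]
      _ ≤ ‖θ‖⁻¹ * (‖V‖ * (2 * ‖x‖)) := by
        gcongr
        exact (V.le_opNorm _).trans (by gcongr; exact hJn x)
      _ = _ := by ring

/-- The graph is a closed subspace, so the quotient map by it is continuous and linear and passes
under the integral, where it kills the integrand. -/
theorem intervalIntegral_mem_graph [CompleteSpace E] {A : E →ₗ.[ℂ] E} (hA : A.IsClosed)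
    {f g : ℝ → E} {a b : ℝ} (hab : a ≤ b) (hf : IntervalIntegrable f volume a b)
    (hg : IntervalIntegrable g volume a b) (h : ∀ s ∈ Icc a b, (f s, g s) ∈ A.graph) :
    (∫ s in a..b, f s, ∫ s in a..b, g s) ∈ A.graph := by
  have : _root_.IsClosed (A.graph : Set (E × E)) := hA
  have hfg : IntervalIntegrable (fun s => (f s, g s)) volume a b := by
    rw [intervalIntegrable_iff] at *
    exact hf.prodMk hg
  have e : (∫ s in a..b, f s, ∫ s in a..b, g s) = ∫ s in a..b, (f s, g s) := by
    ext
    · exact (ContinuousLinearMap.fst ℂ E E).intervalIntegral_comp_comm hfg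
    · exact (ContinuousLinearMap.snd ℂ E E).intervalIntegral_comp_comm hfg
  rw [e, ← Submodule.Quotient.mk_eq_zero]
  have h2 := (A.graph.mkQL).intervalIntegral_comp_comm hfg
  change _ = Submodule.Quotient.mk _ at h2
  rw [← h2]
  refine (intervalIntegral.integral_congr (g := fun _ => 0) fun s hs => ?_).trans (by simp)
  rw [uIcc_of_le hab] at hs
  exact (Submodule.Quotient.mk_eq_zero _).2 (h s hs)

/-! ### Iterated primitives -/

section Primitives

variable [CompleteSpace E] {f : ℝ → E}

theorem hasDerivAt_exp_neg_mul (z : ℂ) (s : ℝ) :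
    HasDerivAt (fun s : ℝ => Complex.exp (-(z * (s : ℂ))))
      (-z * Complex.exp (-(z * (s : ℂ)))) s := by
  have h1 : HasDerivAt (fun s : ℝ => -(z * (s : ℂ))) (-z) s := by
    simpa using ((hasDerivAt_id s).ofReal_comp.const_mul z).fun_neg
  simpa [mul_comm] using h1.cexp

theorem continuous_exp_neg_mul (z : ℂ) : Continuous fun s : ℝ => Complex.exp (-(z * (s : ℂ))) := by
  fun_prop

theorem norm_exp_neg_mul (z : ℂ) (s : ℝ) :
    ‖Complex.exp (-(z * (s : ℂ)))‖ = Real.exp (-(z.re * s)) := by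
  simp [Complex.norm_exp]

theorem hasDerivAt_primitive (hf : Continuous f) (s : ℝ) :
    HasDerivAt (fun r => ∫ u in (0 : ℝ)..r, f u) (f s) s :=
  intervalIntegral.integral_hasDerivAt_right (hf.intervalIntegrable _ _)
    hf.aestronglyMeasurable.stronglyMeasurableAtFilter hf.continuousAt

theorem continuous_primitive_of_continuous (hf : Continuous f) :
    Continuous fun r => ∫ u in (0 : ℝ)..r, f u :=
  continuous_iff_continuousAt.2 fun s => (hasDerivAt_primitive hf s).continuousAt

/-- Rewrites the kernel of the cosine identity as a double primitive, the form suited to integrating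
a Laplace integral by parts. -/
theorem integral_sub_smul_eq (hf : Continuous f) (r : ℝ) :
    ∫ s in (0 : ℝ)..r, ((r - s : ℝ) : ℂ) • f s = ∫ s in (0 : ℝ)..r, ∫ u in (0 : ℝ)..s, f u := by
  have h1 : ∀ s ∈ uIcc 0 r, HasDerivAt (fun s : ℝ => ((r - s : ℝ) : ℂ)) (-1) s := fun s _ => by
    simpa using ((hasDerivAt_id s).const_sub r).ofReal_comp
  rw [intervalIntegral.integral_smul_deriv_eq_deriv_smul_of_hasDerivAt
    (v := fun s => ∫ u in (0 : ℝ)..s, f u) (u' := fun _ => -1) (by fun_prop)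
    (continuous_primitive_of_continuous hf).continuousOn (fun s hs => h1 s (Ioo_subset_Icc_self hs))
    (fun s _ => hasDerivAt_primitive hf s) (by simp)
    (hf.intervalIntegrable _ _)]
  simp

theorem integral_exp_smul (hf : Continuous f) (z : ℂ) (t : ℝ) :
    ∫ s in (0 : ℝ)..t, Complex.exp (-(z * (s : ℂ))) • f s
      = Complex.exp (-(z * (t : ℂ))) • (∫ s in (0 : ℝ)..t, f s)
        + z • ∫ s in (0 : ℝ)..t, Complex.exp (-(z * (s : ℂ))) • ∫ u in (0 : ℝ)..s, f u := by
  rw [intervalIntegral.integral_smul_deriv_eq_deriv_smul_of_hasDerivAt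
    (v := fun s => ∫ u in (0 : ℝ)..s, f u)
    (u' := fun s : ℝ => -z * Complex.exp (-(z * (s : ℂ))))
    (continuous_exp_neg_mul z).continuousOn
    (continuous_primitive_of_continuous hf).continuousOn
    (fun s _ => hasDerivAt_exp_neg_mul z s)
    (fun s _ => hasDerivAt_primitive hf s)
    ((continuous_exp_neg_mul z).const_smul (-z) |>.intervalIntegrable _ _)
    (hf.intervalIntegrable _ _)]
  simp [mul_smul, intervalIntegral.integral_smul]

/-- Primitives vanish at `0`, so only the endpoint `t` contributes; that contribution is the error
operator of the approximate resolvent. -/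
theorem integral_exp_smul_twice (hf : Continuous f) (z : ℂ) (t : ℝ) :
    ∫ s in (0 : ℝ)..t, Complex.exp (-(z * (s : ℂ))) • f s
      = Complex.exp (-(z * (t : ℂ))) • ((∫ s in (0 : ℝ)..t, f s)
          + z • ∫ s in (0 : ℝ)..t, ∫ u in (0 : ℝ)..s, f u)
        + z ^ 2 • ∫ s in (0 : ℝ)..t, Complex.exp (-(z * (s : ℂ))) •
            ∫ u in (0 : ℝ)..s, ∫ w in (0 : ℝ)..u, f w := by
  rw [integral_exp_smul hf, integral_exp_smul (continuous_primitive_of_continuous hf)]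
  module

omit [CompleteSpace E] in
theorem norm_primitive_le {g : ℝ → E} {N t : ℝ} (hN : ∀ s ∈ Icc 0 t, ‖g s‖ ≤ N) {s : ℝ}
    (hs : s ∈ Icc 0 t) : ‖∫ u in (0 : ℝ)..s, g u‖ ≤ t * N := by
  have hN0 : 0 ≤ N := (norm_nonneg _).trans (hN s hs)
  have h1 : ‖∫ u in (0 : ℝ)..s, g u‖ ≤ N * |s - 0| :=
    intervalIntegral.norm_integral_le_of_norm_le_const fun u hu => by
      rw [uIoc_of_le hs.1] at hu
      exact hN u ⟨hu.1.le, hu.2.trans hs.2⟩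
  rw [sub_zero, abs_of_nonneg hs.1] at h1
  nlinarith [hs.2]

end Primitives

end ConvCosine

namespace ConvCosine

/-! ### The Laplace transform of the primitive -/

theorem intervalIntegrable_of_locallyIntegrableOn {K : ℝ → ℂ}
    (hK : LocallyIntegrableOn K (Ici 0)) {t : ℝ} (ht : 0 ≤ t) :
    IntervalIntegrable K volume 0 t := by
  rw [intervalIntegrable_iff_integrableOn_Icc_of_le ht]
  exact hK.integrableOn_compact_subset Icc_subset_Ici_self isCompact_Icc

theorem continuousOn_primitive_uIcc {K : ℝ → ℂ} (hK : LocallyIntegrableOn K (Ici 0)) {t : ℝ}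
    (ht : 0 ≤ t) : ContinuousOn (primitive K) (uIcc 0 t) := by
  refine intervalIntegral.continuousOn_primitive_interval ?_
  rw [uIcc_of_le ht]
  exact hK.integrableOn_compact_subset Icc_subset_Ici_self isCompact_Icc

theorem intervalIntegrable_exp_mul_primitive {K : ℝ → ℂ} (hK : LocallyIntegrableOn K (Ici 0))
    (z : ℂ) {t : ℝ} (ht : 0 ≤ t) :
    IntervalIntegrable (fun s : ℝ => Complex.exp (-(z * (s : ℂ))) * primitive K s) volume 0 t :=
  ((continuous_exp_neg_mul z).continuousOn.mul
    (continuousOn_primitive_uIcc hK ht)).intervalIntegrable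

/-- Integration by parts, for a locally integrable function and its primitive. -/
theorem laplaceTrunc_eq_primitive {K : ℝ → ℂ} (hK : LocallyIntegrableOn K (Ici 0)) (z : ℂ) {t : ℝ}
    (ht : 0 ≤ t) :
    laplaceTrunc K z t = Complex.exp (-(z * (t : ℂ))) * primitive K t
      + z * laplaceTrunc (primitive K) z t := by
  have hKi := intervalIntegrable_of_locallyIntegrableOn hK ht
  set e : ℝ → ℂ := fun s => Complex.exp (-(z * (s : ℂ))) with he
  have hec : Continuous e := continuous_exp_neg_mul z
  have hKr : Integrable K (volume.restrict (uIoc 0 t)) := by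
    rw [← IntegrableOn, ← intervalIntegrable_iff]; exact hKi
  have her : Integrable e (volume.restrict (uIoc 0 t)) := by
    rw [← IntegrableOn, ← intervalIntegrable_iff]; exact hec.intervalIntegrable _ _
  -- Since `K` is only locally integrable, its primitive need not be differentiable everywhere;
  -- Fubini on the triangle `s < r` replaces the product rule.
  have hprod : Integrable (Function.uncurry fun s r : ℝ =>
      (Iio r).indicator (fun s => e r * K s) s)
      ((volume.restrict (uIoc 0 t)).prod (volume.restrict (uIoc 0 t))) := by
    have h1 := (hKr.mul_prod her).indicator
      (measurableSet_lt measurable_fst measurable_snd : MeasurableSet {p : ℝ × ℝ | p.1 < p.2})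
    refine h1.congr (Eventually.of_forall fun p => ?_)
    by_cases hp : p.1 < p.2 <;> simp [Function.uncurry, indicator, hp, mul_comm]
  rw [Measure.prod_restrict] at hprod
  have hswap := intervalIntegral_intervalIntegral_swap hprod
  have hinner1 : ∀ s ∈ uIcc 0 t, z * ∫ r in (0 : ℝ)..t, (Iio r).indicator (fun s => e r * K s) s
      = (e s - e t) * K s := fun s hs => by
    rw [uIcc_of_le ht] at hs
    have h1 : ∫ r in (0 : ℝ)..t, (Iio r).indicator (fun s => e r * K s) s
        = ∫ r in s..t, e r * K s := by
      rw [intervalIntegral.integral_of_le ht, intervalIntegral.integral_of_le hs.2]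
      have h2 : (fun r => (Iio r).indicator (fun s => e r * K s) s)
          = (Ioi s).indicator fun r => e r * K s := by
        ext r; simp [indicator]
      rw [h2, setIntegral_indicator measurableSet_Ioi]
      congr 2
      ext r; simp only [mem_inter_iff, mem_Ioc, mem_Ioi]
      constructor
      · rintro ⟨h, h'⟩; exact ⟨h', h.2⟩
      · rintro ⟨h, h'⟩; exact ⟨⟨hs.1.trans_lt h, h'⟩, h⟩
    have h3 : ∫ r in s..t, -z * e r = e t - e s :=
      intervalIntegral.integral_eq_sub_of_hasDerivAt (fun r _ => hasDerivAt_exp_neg_mul z r)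
        ((hec.const_smul (-z)).intervalIntegrable _ _)
    rw [h1, intervalIntegral.integral_mul_const, ← mul_assoc]
    rw [intervalIntegral.integral_const_mul] at h3
    congr 1
    linear_combination -h3
  have hinner2 : ∀ r ∈ uIcc 0 t, ∫ s in (0 : ℝ)..t, (Iio r).indicator (fun s => e r * K s) s
      = e r * primitive K r := fun r hr => by
    rw [uIcc_of_le ht] at hr
    rw [intervalIntegral.integral_of_le ht, setIntegral_indicator measurableSet_Iio, primitive,
      intervalIntegral.integral_of_le hr.1, integral_Ioc_eq_integral_Ioo, ← integral_const_mul]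
    congr 2
    ext s; simp only [mem_inter_iff, mem_Ioc, mem_Iio, mem_Ioo]
    constructor
    · rintro ⟨h, h'⟩; exact ⟨h.1, h'⟩
    · rintro ⟨h, h'⟩; exact ⟨⟨h, (h'.trans_le hr.2).le⟩, h'⟩
  rw [intervalIntegral.integral_congr hinner2] at hswap
  have h4 : z * laplaceTrunc (primitive K) z t = ∫ s in (0 : ℝ)..t, (e s - e t) * K s := by
    rw [laplaceTrunc, ← hswap, ← intervalIntegral.integral_const_mul]
    exact intervalIntegral.integral_congr hinner1
  have h5 : ∫ s in (0 : ℝ)..t, (e s - e t) * K s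
      = laplaceTrunc K z t - e t * primitive K t := by
    simp only [sub_mul]
    rw [intervalIntegral.integral_sub (hKi.continuousOn_mul hec.continuousOn)
      (hKi.const_mul _), intervalIntegral.integral_const_mul]
    rfl
  rw [h4, h5]; ring

/-! ### Laplace integrals of an exponentially bounded primitive -/

section Growth

variable {K : ℝ → ℂ} (hK : LocallyIntegrableOn K (Ici 0)) {M β : ℝ}
  (hΘ : ∀ t : ℝ, 0 ≤ t → ‖primitive K t‖ ≤ M * Real.exp (β * t))

include hK hΘ

theorem tendsto_laplaceTrunc_primitive {z : ℂ} (hz : β < z.re) :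
    Tendsto (laplaceTrunc (primitive K) z) atTop (𝓝 (laplace (primitive K) z)) := by
  have hc : ContinuousOn (fun s : ℝ => Complex.exp (-(z * (s : ℂ))) * primitive K s) (Ici 0) := by
    refine (continuous_exp_neg_mul z).continuousOn.mul fun s hs => ?_
    have h1 := continuousOn_primitive_uIcc hK (show (0 : ℝ) ≤ s + 1 by linarith [mem_Ici.1 hs]) s
      (by rw [uIcc_of_le (by linarith [mem_Ici.1 hs])]; exact ⟨hs, by linarith⟩)
    refine h1.mono_of_mem_nhdsWithin ?_
    rw [uIcc_of_le (by linarith [mem_Ici.1 hs]), ← Ici_inter_Iic]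
    exact inter_mem self_mem_nhdsWithin (mem_nhdsWithin_of_mem_nhds (Iic_mem_nhds (by linarith)))
  have hint : IntegrableOn (fun s : ℝ => Complex.exp (-(z * (s : ℂ))) * primitive K s)
      (Ioi 0) := by
    refine Integrable.mono' ((exp_neg_integrableOn_Ioi 0 (sub_pos.2 hz)).const_mul M)
      ((hc.mono Ioi_subset_Ici_self).aestronglyMeasurable measurableSet_Ioi) ?_
    refine (ae_restrict_iff' measurableSet_Ioi).2 (Eventually.of_forall fun s hs => ?_)
    rw [norm_mul, norm_exp_neg_mul]
    calc _ ≤ Real.exp (-(z.re * s)) * (M * Real.exp (β * s)) := by gcongr; exact hΘ s (le_of_lt hs)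
      _ = M * (Real.exp (-(z.re * s)) * Real.exp (β * s)) := by ring
      _ = M * Real.exp (-(z.re - β) * s) := by rw [← Real.exp_add]; ring_nf
  exact tendsto_nhds_limUnder
    ⟨_, intervalIntegral_tendsto_integral_Ioi 0 hint tendsto_id⟩

/-- The margin `1` makes the factor `1 / (Re z - β)` from integrating the tail at most `1`, so the
constant does not depend on `z`. -/
theorem norm_laplace_sub_laplaceTrunc_le {z : ℂ} (hz : β + 1 ≤ z.re) {t : ℝ} (ht : 0 ≤ t) :
    ‖laplace (primitive K) z - laplaceTrunc (primitive K) z t‖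
      ≤ M * Real.exp (β * t) * Real.exp (-(t * z.re)) := by
  have hM : 0 ≤ M := by simpa using (norm_nonneg _).trans (hΘ 0 le_rfl)
  refine le_of_tendsto ((tendsto_laplaceTrunc_primitive hK hΘ (by linarith)).sub_const _).norm ?_
  filter_upwards [eventually_ge_atTop t] with T hT
  have h1 : laplaceTrunc (primitive K) z T - laplaceTrunc (primitive K) z t
      = ∫ s in t..T, Complex.exp (-(z * (s : ℂ))) * primitive K s :=
    intervalIntegral.integral_interval_sub_left
      (intervalIntegrable_exp_mul_primitive hK z (ht.trans hT))
      (intervalIntegrable_exp_mul_primitive hK z ht)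
  have hd : ∀ s : ℝ, HasDerivAt (fun s : ℝ => -(M / (z.re - β)) * Real.exp (-(z.re - β) * s))
      (M * Real.exp (-(z.re - β) * s)) s := fun s => by
    have h2 := ((((hasDerivAt_id s).const_mul (-(z.re - β))).exp).const_mul (-(M / (z.re - β))))
    have h3 : z.re - β ≠ 0 := by linarith
    refine h2.congr_deriv ?_
    simp only [id]
    field_simp
  have hci : Continuous fun s : ℝ => M * Real.exp (-(z.re - β) * s) := by fun_prop
  rw [h1]
  calc _ ≤ ∫ s in t..T, M * Real.exp (-(z.re - β) * s) := by
        refine intervalIntegral.norm_integral_le_of_norm_le hT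
          (Eventually.of_forall fun s hs => ?_) (hci.intervalIntegrable _ _)
        rw [norm_mul, norm_exp_neg_mul]
        calc _ ≤ Real.exp (-(z.re * s)) * (M * Real.exp (β * s)) := by
              gcongr; exact hΘ s (ht.trans hs.1.le)
          _ = M * (Real.exp (-(z.re * s)) * Real.exp (β * s)) := by ring
          _ = M * Real.exp (-(z.re - β) * s) := by rw [← Real.exp_add]; ring_nf
    _ = M / (z.re - β) * (Real.exp (-(z.re - β) * t) - Real.exp (-(z.re - β) * T)) := by
        rw [intervalIntegral.integral_eq_sub_of_hasDerivAt (fun s _ => hd s)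
          (hci.intervalIntegrable _ _)]
        ring
    _ ≤ M * Real.exp (-(z.re - β) * t) := by
        refine mul_le_mul (div_le_self hM (by linarith))
          (sub_le_self _ (Real.exp_pos _).le) (sub_nonneg.2 (Real.exp_le_exp.2 ?_)) hM
        nlinarith
    _ = _ := by rw [mul_assoc, ← Real.exp_add]; ring_nf

/-- Carries nonvanishing of the transform of `K` over to that of `Θ`. -/
theorem laplace_eq_mul_laplace_primitive {z : ℂ} (hz : β < z.re) :
    laplace K z = z * laplace (primitive K) z := by
  have h0 : Tendsto (fun t : ℝ => Complex.exp (-(z * (t : ℂ))) * primitive K t) atTop (𝓝 0) := by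
    have h1 : Tendsto (fun t : ℝ => M * Real.exp (-(z.re - β) * t)) atTop (𝓝 0) := by
      have h2 : Tendsto (fun t : ℝ => -(z.re - β) * t) atTop atBot :=
        tendsto_id.const_mul_atTop_of_neg (by linarith)
      simpa using (Real.tendsto_exp_atBot.comp h2).const_mul M
    refine squeeze_zero_norm' ?_ h1
    filter_upwards [eventually_ge_atTop 0] with t ht
    rw [norm_mul, norm_exp_neg_mul]
    calc _ ≤ Real.exp (-(z.re * t)) * (M * Real.exp (β * t)) := by gcongr; exact hΘ t ht
      _ = M * (Real.exp (-(z.re * t)) * Real.exp (β * t)) := by ring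
      _ = M * Real.exp (-(z.re - β) * t) := by rw [← Real.exp_add]; ring_nf
  have h3 := h0.add ((tendsto_laplaceTrunc_primitive hK hΘ hz).const_mul z)
  rw [zero_add] at h3
  refine Tendsto.limUnder_eq (h3.congr' ?_)
  filter_upwards [eventually_ge_atTop 0] with t ht
  exact (laplaceTrunc_eq_primitive hK z ht).symm

end Growth

end ConvCosine

namespace ConvCosine

variable {E : Type*} [NormedAddCommGroup E] [NormedSpace ℂ E]

/-! ### Approximate resolvents of the generator -/

theorem Icc_subset_timeInterval {τ : EReal} {t : ℝ} (ht : t ∈ timeInterval τ) :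
    Icc 0 t ⊆ timeInterval τ := fun _ hs =>
  ⟨hs.1, (EReal.coe_le_coe_iff.2 hs.2).trans_lt ht.2⟩

theorem projIcc_mem {t : ℝ} (ht : 0 ≤ t) (s : ℝ) : max 0 (min s t) ∈ Icc 0 t :=
  ⟨le_max_left _ _, max_le ht (min_le_right _ _)⟩

theorem projIcc_eq {t s : ℝ} (hs : s ∈ Icc 0 t) : max 0 (min s t) = s := by
  rw [min_eq_left hs.2, max_eq_right hs.1]

variable [CompleteSpace E]

theorem exists_norm_le_of_strongCont {τ : EReal} {C : ℝ → E →L[ℂ] E}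
    (hC : ∀ x : E, ContinuousOn (fun t => C t x) (timeInterval τ)) {t : ℝ}
    (ht : t ∈ timeInterval τ) : ∃ N, 0 ≤ N ∧ ∀ s ∈ Icc 0 t, ‖C s‖ ≤ N := by
  obtain ⟨N, hN⟩ := banach_steinhaus (g := fun s : Icc 0 t => C s) fun x => by
    obtain ⟨b, hb⟩ := isCompact_Icc.exists_bound_of_continuousOn
      ((hC x).mono (Icc_subset_timeInterval ht))
    exact ⟨b, fun s => hb s s.2⟩
  exact ⟨N, (norm_nonneg _).trans (hN ⟨0, le_rfl, ht.1⟩), fun s hs => hN ⟨s, hs⟩⟩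

/-- The subgenerator is contained in the generator. -/
theorem graph_le_of_isSubgenerator {A B : E →ₗ.[ℂ] E} {K : ℝ → ℂ} {τ : EReal}
    {C : ℝ → E →L[ℂ] E} (hB : IsSubgenerator B K τ C)
    (hA : ∀ x y : E, (x, y) ∈ A.graph ↔ ∀ t ∈ timeInterval τ,
        C t x - primitive K t • x = ∫ s in (0 : ℝ)..t, ((t - s : ℝ) : ℂ) • C s y) :
    B.graph ≤ A.graph := by
  rintro ⟨x, y⟩ hxy
  refine (hA x y).2 fun t ht => ?_
  have hcont : ∀ w, IntervalIntegrable (fun s => ((t - s : ℝ) : ℂ) • C s w) volume 0 t := fun w => by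
    refine ContinuousOn.intervalIntegrable (ContinuousOn.smul (by fun_prop) ?_)
    rw [uIcc_of_le ht.1]
    exact (hB.strongCont w).mono (Icc_subset_timeInterval ht)
  -- `B` applied to `∫ (t - s) C s x` is now known in two ways, by commutation and by the defining
  -- identity; single-valuedness equates them.
  have h1 := intervalIntegral_mem_graph hB.closed ht.1 (hcont x) (hcont y) fun s hs => by
    obtain ⟨x', rfl, rfl⟩ := B.mem_graph_iff.1 hxy
    obtain ⟨hd, he⟩ := hB.comm s (Icc_subset_timeInterval ht hs) x'
    have := B.mem_graph ⟨_, hd⟩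
    rw [he] at this
    exact B.graph.smul_mem _ this
  obtain ⟨hd, he⟩ := hB.integral t ht x
  have h2 := B.mem_graph ⟨_, hd⟩
  rw [he] at h2
  exact B.mem_graph_snd_inj' h2 h1 rfl

/-- `V` is the truncated Laplace integral of the second primitive and `D` the boundary term at `t`;
`N` is uniform over the closed right half plane, where `|e^{-zs}| ≤ 1`. -/
theorem exists_approx_resolvent {A : E →ₗ.[ℂ] E} {K : ℝ → ℂ}
    (hK : LocallyIntegrableOn K (Ici 0)) {τ : EReal} {C : ℝ → E →L[ℂ] E}
    (hgen : IsGenerator A K τ C) {t : ℝ} (ht : t ∈ timeInterval τ) :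
    ∃ N : ℝ, 0 ≤ N ∧ ∀ z : ℂ, 0 ≤ z.re → ∃ V D : E →L[ℂ] E,
      ‖z‖ * ‖V‖ ≤ N ∧ ‖D‖ ≤ N * (1 + ‖z‖) * Real.exp (-(t * z.re)) ∧
      (∀ x, (V x, z ^ 2 • V x - (laplaceTrunc (primitive K) z t • x - D x)) ∈ A.graph) ∧
      ∀ x, (x, z ^ 2 • x) ∈ A.graph → laplaceTrunc (primitive K) z t • x = D x := by
  obtain ⟨⟨B, hB⟩, hA⟩ := hgen
  have hBA := graph_le_of_isSubgenerator hB hA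
  obtain ⟨N, hN0, hN⟩ := exists_norm_le_of_strongCont hB.strongCont ht
  have ht0 : 0 ≤ t := ht.1
  -- Clamping time to `[0, t]` makes the orbits continuous on all of `ℝ`.
  set c : E → ℝ → E := fun x s => C (max 0 (min s t)) x with hc
  have hcc : ∀ x, Continuous (c x) := fun x =>
    (hB.strongCont x).comp_continuous (by fun_prop)
      fun s => Icc_subset_timeInterval ht (projIcc_mem ht0 s)
  have hcN : ∀ x, ∀ s ∈ Icc 0 t, ‖c x s‖ ≤ N * ‖x‖ := fun x s hs =>
    (C _).le_of_opNorm_le (hN _ (projIcc_mem ht0 s)) x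
  have hceq : ∀ x, ∀ s ∈ Icc 0 t, c x s = C s x := fun x s hs => by
    simp only [hc, projIcc_eq hs]
  set S : E → ℝ → E := fun x r => ∫ s in (0 : ℝ)..r, c x s with hS
  set U : E → ℝ → E := fun x r => ∫ s in (0 : ℝ)..r, S x s with hU
  have hSc : ∀ x, Continuous (S x) := fun x => continuous_primitive_of_continuous (hcc x)
  have hUc : ∀ x, Continuous (U x) := fun x => continuous_primitive_of_continuous (hSc x)
  have hSN : ∀ x, ∀ s ∈ Icc 0 t, ‖S x s‖ ≤ t * (N * ‖x‖) := fun x s hs =>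
    norm_primitive_le (hcN x) hs
  have hUN : ∀ x, ∀ s ∈ Icc 0 t, ‖U x s‖ ≤ t * (t * (N * ‖x‖)) := fun x s hs =>
    norm_primitive_le (hSN x) hs
  have hSadd : ∀ x y r, S (x + y) r = S x r + S y r := fun x y r => by
    simp only [hS, hc, map_add]
    exact intervalIntegral.integral_add ((hcc x).intervalIntegrable _ _)
      ((hcc y).intervalIntegrable _ _)
  have hSsmul : ∀ (a : ℂ) x r, S (a • x) r = a • S x r := fun a x r => by
    simp only [hS, hc, map_smul, intervalIntegral.integral_smul]
  have hUadd : ∀ x y r, U (x + y) r = U x r + U y r := fun x y r => by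
    simp only [hU, hSadd]
    exact intervalIntegral.integral_add ((hSc x).intervalIntegrable _ _)
      ((hSc y).intervalIntegrable _ _)
  have hUsmul : ∀ (a : ℂ) x r, U (a • x) r = a • U x r := fun a x r => by
    simp only [hU, hSsmul, intervalIntegral.integral_smul]
  have hUeq : ∀ x, ∀ r ∈ Icc 0 t, ∫ s in (0 : ℝ)..r, ((r - s : ℝ) : ℂ) • C s x = U x r :=
    fun x r hr => by
      simp only [hU, hS]
      rw [← integral_sub_smul_eq (hcc x)]
      refine intervalIntegral.integral_congr fun s hs => ?_
      rw [uIcc_of_le hr.1] at hs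
      simp only [hceq x s ⟨hs.1, hs.2.trans hr.2⟩]
  have hexpc : ∀ (z : ℂ) {g : ℝ → E}, Continuous g →
      IntervalIntegrable (fun s : ℝ => Complex.exp (-(z * (s : ℂ))) • g s) volume 0 t :=
    fun z g hg => ((continuous_exp_neg_mul z).smul hg).intervalIntegrable _ _
  have hΘi : ∀ (z : ℂ) (x : E), IntervalIntegrable
      (fun s : ℝ => Complex.exp (-(z * (s : ℂ))) • primitive K s • x) volume 0 t := fun z x =>
    ((continuous_exp_neg_mul z).continuousOn.smul
      ((continuousOn_primitive_uIcc hK ht0).smul continuousOn_const)).intervalIntegrable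
  have hΘint : ∀ (z : ℂ) (x : E),
      ∫ s in (0 : ℝ)..t, Complex.exp (-(z * (s : ℂ))) • primitive K s • x
        = laplaceTrunc (primitive K) z t • x := fun z x => by
    simp only [smul_smul]
    exact intervalIntegral.integral_smul_const _ x
  refine ⟨t * N + t * (t * N) + t * (t * N), by positivity, fun z hz => ?_⟩
  have hexp1 : ∀ s ∈ Icc 0 t, ‖Complex.exp (-(z * (s : ℂ)))‖ ≤ 1 := fun s hs => by
    rw [norm_exp_neg_mul, Real.exp_le_one_iff]
    nlinarith [hs.1]
  let Vl : E →ₗ[ℂ] E :=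
    { toFun := fun x => ∫ s in (0 : ℝ)..t, Complex.exp (-(z * (s : ℂ))) • U x s
      map_add' := fun x y => by
        simp only [hUadd, smul_add]
        exact intervalIntegral.integral_add (hexpc z (hUc x)) (hexpc z (hUc y))
      map_smul' := fun a x => by
        simp only [hUsmul, RingHom.id_apply, ← intervalIntegral.integral_smul]
        simp only [smul_comm _ a] }
  let Dl : E →ₗ[ℂ] E :=
    { toFun := fun x => Complex.exp (-(z * (t : ℂ))) • (S x t + z • U x t)
      map_add' := fun x y => by
        rw [hSadd, hUadd]; module
      map_smul' := fun a x => by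
        rw [hSsmul, hUsmul, RingHom.id_apply]; module }
  have hVl : ∀ x, ‖Vl x‖ ≤ t * (t * (t * N)) * ‖x‖ := fun x => by
    have h1 : ‖Vl x‖ ≤ (t * (t * (N * ‖x‖))) * |t - 0| :=
      intervalIntegral.norm_integral_le_of_norm_le_const fun s hs => by
        rw [uIoc_of_le ht0] at hs
        rw [norm_smul, ← one_mul (t * (t * (N * ‖x‖)))]
        exact mul_le_mul (hexp1 s ⟨hs.1.le, hs.2⟩) (hUN x s ⟨hs.1.le, hs.2⟩) (norm_nonneg _)
          zero_le_one
    rw [sub_zero, abs_of_nonneg ht0] at h1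
    linarith
  -- One integration by parts absorbs the factor `z`; this is the source of the decay `1 / (1 +
  -- |z|)` of the resolvent.
  have hzVl : ∀ x, ‖z • Vl x‖ ≤ (t * (t * N) + t * (t * N)) * ‖x‖ := fun x => by
    have h1 : z • Vl x = (∫ s in (0 : ℝ)..t, Complex.exp (-(z * (s : ℂ))) • S x s)
        - Complex.exp (-(z * (t : ℂ))) • U x t := by
      rw [integral_exp_smul (hSc x) z t]
      simp [Vl, hU]
    have h2 : ‖∫ s in (0 : ℝ)..t, Complex.exp (-(z * (s : ℂ))) • S x s‖
        ≤ (t * (N * ‖x‖)) * |t - 0| :=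
      intervalIntegral.norm_integral_le_of_norm_le_const fun s hs => by
        rw [uIoc_of_le ht0] at hs
        rw [norm_smul, ← one_mul (t * (N * ‖x‖))]
        exact mul_le_mul (hexp1 s ⟨hs.1.le, hs.2⟩) (hSN x s ⟨hs.1.le, hs.2⟩) (norm_nonneg _)
          zero_le_one
    have h3 : ‖Complex.exp (-(z * (t : ℂ))) • U x t‖ ≤ 1 * (t * (t * (N * ‖x‖))) := by
      rw [norm_smul]
      exact mul_le_mul (hexp1 t ⟨ht0, le_rfl⟩) (hUN x t ⟨ht0, le_rfl⟩) (norm_nonneg _)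
        zero_le_one
    rw [sub_zero, abs_of_nonneg ht0] at h2
    rw [h1]
    refine (norm_sub_le _ _).trans ((add_le_add h2 h3).trans (le_of_eq ?_))
    ring
  have hDl : ∀ x, ‖Dl x‖ ≤ ((t * N + t * (t * N)) * (1 + ‖z‖) * Real.exp (-(t * z.re))) * ‖x‖ :=
    fun x => by
      have h1 : ‖S x t + z • U x t‖ ≤ t * (N * ‖x‖) + ‖z‖ * (t * (t * (N * ‖x‖))) := by
        refine (norm_add_le _ _).trans (add_le_add (hSN x t ⟨ht0, le_rfl⟩) ?_)
        rw [norm_smul]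
        exact mul_le_mul_of_nonneg_left (hUN x t ⟨ht0, le_rfl⟩) (norm_nonneg _)
      have h2 : 0 ≤ t * (N * ‖x‖) * ‖z‖ := by positivity
      have h3 : 0 ≤ t * (t * (N * ‖x‖)) := by positivity
      calc ‖Dl x‖ = Real.exp (-(t * z.re)) * ‖S x t + z • U x t‖ := by
            simp only [Dl, LinearMap.coe_mk, AddHom.coe_mk, norm_smul, norm_exp_neg_mul]
            rw [mul_comm t]
        _ ≤ Real.exp (-(t * z.re)) * ((t * N + t * (t * N)) * (1 + ‖z‖) * ‖x‖) := by
            gcongr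
            linarith
        _ = _ := by ring
  refine ⟨Vl.mkContinuous _ hVl, Dl.mkContinuous _ hDl, ?_, ?_, fun x => ?_, fun x hx => ?_⟩
  · rw [← norm_smul]
    refine (ContinuousLinearMap.opNorm_le_bound _ (by positivity) hzVl).trans ?_
    nlinarith [mul_nonneg ht0 hN0]
  · refine (Dl.mkContinuous_norm_le (by positivity) hDl).trans ?_
    gcongr
    have : 0 ≤ t * (t * N) := by positivity
    linarith
  · refine hBA ?_
    have h1 : IntervalIntegrable
        (fun s : ℝ => Complex.exp (-(z * (s : ℂ))) • (c x s - primitive K s • x)) volume 0 t := by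
      simp only [smul_sub]
      exact (hexpc z (hcc x)).sub (hΘi z x)
    have h2 := intervalIntegral_mem_graph hB.closed ht0 (hexpc z (hUc x)) h1 fun s hs => by
      obtain ⟨hd, he⟩ := hB.integral s (Icc_subset_timeInterval ht hs) x
      have h3 := B.mem_graph ⟨_, hd⟩
      rw [he] at h3
      simp only [hUeq x s hs, ← hceq x s hs] at h3
      exact B.graph.smul_mem _ h3
    have h4 : ∫ s in (0 : ℝ)..t, Complex.exp (-(z * (s : ℂ))) • (c x s - primitive K s • x)
        = z ^ 2 • Vl x - (laplaceTrunc (primitive K) z t • x - Dl x) := by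
      simp only [smul_sub]
      rw [intervalIntegral.integral_sub (hexpc z (hcc x)) (hΘi z x), hΘint,
        integral_exp_smul_twice (hcc x)]
      simp only [Vl, Dl, LinearMap.coe_mk, AddHom.coe_mk]
      abel
    rw [h4] at h2
    exact h2
  -- On an eigenvector the generator identity reads `Θ(s)x = C s x - z² U(s)x`; in its Laplace
  -- integral the `z²` terms cancel and only the boundary term survives.
  · have h1 := (hA _ _).1 hx
    have h2 : ∀ s ∈ uIcc 0 t, Complex.exp (-(z * (s : ℂ))) • primitive K s • x
        = Complex.exp (-(z * (s : ℂ))) • c x s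
          - z ^ 2 • (Complex.exp (-(z * (s : ℂ))) • U x s) := fun s hs => by
      rw [uIcc_of_le ht0] at hs
      have h3 := h1 s (Icc_subset_timeInterval ht hs)
      rw [hUeq _ s hs, hUsmul, ← hceq x s hs, sub_eq_iff_eq_add] at h3
      rw [h3]; module
    have h3 : IntervalIntegrable
        (fun s : ℝ => z ^ 2 • (Complex.exp (-(z * (s : ℂ))) • U x s)) volume 0 t :=
      (((continuous_exp_neg_mul z).smul (hUc x)).const_smul (z ^ 2)).intervalIntegrable _ _
    rw [← hΘint, intervalIntegral.integral_congr h2, intervalIntegral.integral_sub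
      (hexpc z (hcc x)) h3, intervalIntegral.integral_smul,
      integral_exp_smul_twice (hcc x), add_sub_cancel_right]
    rfl

/-- Where the Laplace transform of `Θ` is not too small, squares lie in the resolvent set. -/
theorem exists_resolvent_sq_bound {A : E →ₗ.[ℂ] E} {K : ℝ → ℂ}
    (hK : LocallyIntegrableOn K (Ici 0)) {M β : ℝ} (hβ : 0 ≤ β)
    (hΘ : ∀ t : ℝ, 0 ≤ t → ‖primitive K t‖ ≤ M * Real.exp (β * t)) {τ : EReal}
    {C : ℝ → E →L[ℂ] E} (hgen : IsGenerator A K τ C) {t : ℝ} (ht : t ∈ timeInterval τ) :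
    ∃ N : ℝ, 0 < N ∧ ∀ z : ℂ, β + 1 ≤ z.re → laplace (primitive K) z ≠ 0 →
      N * (1 + ‖z‖) * Real.exp (-(t * z.re)) * (1 / ‖laplace (primitive K) z‖) ≤ 1 / 2 →
      z ^ 2 ∈ resolventSet A ∧
        ‖z‖ * ‖resolvent A (z ^ 2)‖ ≤ N * (1 / ‖laplace (primitive K) z‖) := by
  obtain ⟨N, hN0, hN⟩ := exists_approx_resolvent hK hgen ht
  have hM : 0 ≤ M := by simpa using (norm_nonneg _).trans (hΘ 0 le_rfl)
  -- `2 * N` comes from the Neumann series, the next term from the tail of the transform, and `1`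
  -- ensures positivity.
  refine ⟨2 * N + M * Real.exp (β * t) + 1, by positivity, fun z hz hne hsmall => ?_⟩
  obtain ⟨V, D₀, hVn, hDn, hV, hinj⟩ := hN z (by linarith)
  have htail := norm_laplace_sub_laplaceTrunc_le hK hΘ hz ht.1
  set θ := laplace (primitive K) z
  set θt := laplaceTrunc (primitive K) z t
  have hθpos : 0 < ‖θ‖ := norm_pos_iff.2 hne
  -- Chosen so that `θ (1 - D) = θt - D₀`: truncation error and boundary term in one operator.
  set D : E →L[ℂ] E := θ⁻¹ • ((θ - θt) • ContinuousLinearMap.id ℂ E + D₀) with hDdef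
  have hθD : ∀ x, θ • D x = (θ - θt) • x + D₀ x := fun x => by
    simp only [hDdef, _root_.smul_apply, _root_.add_apply,
      ContinuousLinearMap.id_apply]
    rw [smul_inv_smul₀ hne]
  have hDnorm : ‖D‖ ≤ 1 / 2 := by
    have h1 : ‖(θ - θt) • ContinuousLinearMap.id ℂ E + D₀‖
        ≤ M * Real.exp (β * t) * Real.exp (-(t * z.re))
          + N * (1 + ‖z‖) * Real.exp (-(t * z.re)) := by
      refine (norm_add_le _ _).trans (add_le_add ?_ hDn)
      rw [norm_smul]
      exact (mul_le_of_le_one_right (norm_nonneg _) ContinuousLinearMap.norm_id_le).trans htail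
    have h2 : M * Real.exp (β * t) * Real.exp (-(t * z.re))
          + N * (1 + ‖z‖) * Real.exp (-(t * z.re))
        ≤ (2 * N + M * Real.exp (β * t) + 1) * (1 + ‖z‖) * Real.exp (-(t * z.re)) := by
      rw [← add_mul]
      gcongr
      have : 0 ≤ M * Real.exp (β * t) * ‖z‖ := by positivity
      nlinarith [norm_nonneg z]
    calc ‖D‖ = ‖(θ - θt) • ContinuousLinearMap.id ℂ E + D₀‖ * (1 / ‖θ‖) := by
          rw [hDdef, norm_smul, norm_inv]; ring
      _ ≤ _ := by gcongr; exact h1.trans h2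
      _ ≤ 1 / 2 := hsmall
  obtain ⟨R, hR, hRn⟩ := exists_isResolventAt_of_approx (A := A) (z := z ^ 2) hne hDnorm
    (fun x => by
      rw [smul_sub, hθD]
      convert hV x using 3
      module)
    (fun x hx => by
      refine smul_right_injective E hne ?_
      simp only [hθD, ← hinj x hx]
      module)
  refine ⟨⟨R, hR⟩, ?_⟩
  rw [resolvent_eq hR]
  calc ‖z‖ * ‖R‖ ≤ ‖z‖ * (2 * ‖V‖ / ‖θ‖) := by gcongr
    _ = 2 * (‖z‖ * ‖V‖) * (1 / ‖θ‖) := by ring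
    _ ≤ (2 * N + M * Real.exp (β * t) + 1) * (1 / ‖θ‖) := by
        gcongr
        have : 0 ≤ M * Real.exp (β * t) := by positivity
        linarith

end ConvCosine

namespace ConvCosine

/-! ### The associated function -/

/-- (M.3)' forces `m p / m (p + 1) → 0`, so `r ^ p / m p` is summable by the ratio test. Without
boundedness the real supremum would take its default value `0`. -/
theorem bddAbove_range_log_div {m : ℕ → ℝ} (hm : IsWeightSeq m) {r : ℝ} (hr : 0 < r) :
    BddAbove (range fun p : ℕ => Real.log (r ^ p / m p)) := by
  have h1 : Tendsto (fun p => ‖r ^ (p + 1) / m (p + 1)‖ / ‖r ^ p / m p‖) atTop (𝓝 0) := by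
    have h2 := hm.m3.tendsto_atTop_zero.const_mul r
    rw [mul_zero] at h2
    refine h2.congr fun p => ?_
    have := hm.pos p
    have := hm.pos (p + 1)
    rw [Real.norm_of_nonneg (by positivity), Real.norm_of_nonneg (by positivity)]
    field_simp
    ring
  have h3 : Summable fun p => r ^ p / m p := by
    refine summable_of_ratio_test_tendsto_lt_one zero_lt_one (Eventually.of_forall fun p => ?_) h1
    have := hm.pos p
    positivity
  obtain ⟨b, hb⟩ := h3.tendsto_atTop_zero.bddAbove_range
  refine ⟨b, ?_⟩
  rintro _ ⟨p, rfl⟩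
  have := hm.pos p
  exact (Real.log_le_self (by positivity)).trans (hb ⟨p, rfl⟩)

theorem log_div_le_assocFun {m : ℕ → ℝ} (hm : IsWeightSeq m) {r : ℝ} (hr : 0 < r) (p : ℕ) :
    Real.log (r ^ p / m p) ≤ assocFun m r := by
  rw [assocFun, if_neg hr.ne']
  exact le_ciSup (bddAbove_range_log_div hm hr) p

theorem assocFun_nonneg {m : ℕ → ℝ} (hm : IsWeightSeq m) {r : ℝ} (hr : 0 ≤ r) :
    0 ≤ assocFun m r := by
  rcases hr.eq_or_lt with rfl | hr
  · simp [assocFun]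
  · simpa [hm.zero] using log_div_le_assocFun hm hr 0

/-- The associated function grows faster than any multiple of the logarithm. -/
theorem exists_le_exp_assocFun {m : ℕ → ℝ} (hm : IsWeightSeq m) {δ : ℝ} (hδ : 0 < δ) :
    ∃ Q : ℝ, 0 < Q ∧ ∀ r : ℝ, 1 ≤ r → r ≤ Q * Real.exp (δ * assocFun m r) := by
  -- The single term of index `p` in the supremum already yields `δ M(r) ≥ log r - δ log (m p)` for
  -- `r ≥ 1`.
  obtain ⟨p, hp⟩ := exists_nat_ge (1 / δ)
  refine ⟨Real.exp (δ * Real.log (m p)), Real.exp_pos _, fun r hr => ?_⟩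
  have hr0 : 0 < r := by linarith
  have h1 := log_div_le_assocFun hm hr0 p
  rw [Real.log_div (by positivity) (hm.pos p).ne', Real.log_pow] at h1
  have h2 : 1 ≤ δ * p := by rwa [div_le_iff₀' hδ] at hp
  have h3 : Real.log r ≤ δ * p * Real.log r := le_mul_of_one_le_left (Real.log_nonneg hr) h2
  rw [← Real.exp_add, ← Real.log_le_iff_le_exp hr0]
  nlinarith [mul_le_mul_of_nonneg_left h1 hδ.le]

/-- Supplies the shift of the region: far enough right to pass every threshold and make the error at
most `1 / 2`. -/
theorem exists_ge_mul_exp_neg_le (P L : ℝ) {t : ℝ} (ht : 0 < t) :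
    ∃ b, L ≤ b ∧ P * Real.exp (-(t * b)) ≤ 1 / 2 := by
  have h1 : Tendsto (fun b : ℝ => -t * b) atTop atBot :=
    tendsto_id.const_mul_atTop_of_neg (by linarith)
  have h2 : Tendsto (fun b : ℝ => P * Real.exp (-t * b)) atTop (𝓝 0) := by
    simpa using (Real.tendsto_exp_atBot.comp h1).const_mul P
  obtain ⟨b, hb, hb'⟩ := ((eventually_ge_atTop L).and
    (h2.eventually (eventually_le_nhds (show (0 : ℝ) < 1 / 2 by norm_num)))).exists
  exact ⟨b, hb, by rwa [neg_mul] at hb'⟩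

/-! ### Resolvents on Ōuchi and ultra-logarithmic regions -/

variable {E : Type*} [NormedAddCommGroup E] [NormedSpace ℂ E] [CompleteSpace E]
  {A : E →ₗ.[ℂ] E} {K : ℝ → ℂ} {C : ℝ → E →L[ℂ] E} {M β : ℝ}

theorem exists_ouchi_resolvent_bound (hK : LocallyIntegrableOn K (Ici 0)) {τ : ℝ} (hβ : 0 < β) (hP2 : CondP2 (primitive K))
    (hΘ : ∀ t : ℝ, 0 ≤ t → ‖primitive K t‖ ≤ M * Real.exp (β * t))
    (hgen : IsGenerator A K (τ : EReal) C) {ε : ℝ} (hε : 0 < ε)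
    (hlow : ∃ c T ε₀ : ℝ, 0 < c ∧ 0 < T ∧ 0 < ε₀ ∧ ε₀ < τ * ε ∧
      ∀ z ∈ ouchi ε c, β < z.re →
        1 / ‖laplace (primitive K) z‖ ≤ T * Real.exp (ε₀ * ‖z‖)) :
    ∃ c k : ℝ, 0 < c ∧ 0 < k ∧ ∀ z ∈ ouchi ε c, z ^ 2 ∈ resolventSet A ∧
      ‖resolvent A (z ^ 2)‖ ≤ k * Real.exp (τ * ε * ‖z‖) := by
  obtain ⟨c, T, ε₀, hc, hT, hε₀, hε₀τ, hlow⟩ := hlow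
  obtain ⟨-, b, -, hb⟩ := hP2
  -- With `ε₀ / ε < t < τ`, the decay `e^{-tε|z|}` beats `e^{ε₀|z|}` and leaves `e^{-δ|z|}` to
  -- absorb `1 + |z|`.
  obtain ⟨t, ht1, ht2⟩ := exists_between ((div_lt_iff₀ hε).2 hε₀τ)
  have ht0 : 0 < t := (div_pos hε₀ hε).trans ht1
  have hδ : 0 < t * ε - ε₀ := sub_pos.2 ((div_lt_iff₀ hε).1 ht1)
  set δ := t * ε - ε₀ with hδdef
  obtain ⟨N, hN0, hN⟩ := exists_resolvent_sq_bound hK hβ.le hΘ hgen (t := t)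
    ⟨ht0.le, EReal.coe_lt_coe_iff.2 ht2⟩
  obtain ⟨c', hc', hsmall⟩ := exists_ge_mul_exp_neg_le (N * T * (1 + 1 / δ))
    (max (max c (β + 1)) (max (b + 1) 1)) ht0
  simp only [max_le_iff] at hc'
  obtain ⟨⟨hc1, hc2⟩, hc3, hc4⟩ := hc'
  refine ⟨c', N * T, by linarith, by positivity, fun z hz => ?_⟩
  have hz' : ε * ‖z‖ + c' ≤ z.re := hz
  have hεz : 0 ≤ ε * ‖z‖ := by positivity
  have hz1 : 1 ≤ ‖z‖ := by linarith [Complex.re_le_norm z]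
  have hl := hlow z (show ε * ‖z‖ + c ≤ z.re by linarith) (by linarith)
  obtain ⟨h1, h2⟩ := hN z (by linarith) (hb z (by linarith)) <| by
    have e1 : Real.exp (-(t * z.re)) * Real.exp (ε₀ * ‖z‖)
        ≤ Real.exp (-(t * c')) * Real.exp (-(δ * ‖z‖)) := by
      rw [← Real.exp_add, ← Real.exp_add, Real.exp_le_exp, hδdef]
      nlinarith [mul_le_mul_of_nonneg_left hz' ht0.le]
    have e2 : (1 + ‖z‖) * Real.exp (-(δ * ‖z‖)) ≤ 1 + 1 / δ := by
      have h3 : (1 + ‖z‖) ≤ (1 + 1 / δ) * Real.exp (δ * ‖z‖) := by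
        calc 1 + ‖z‖ ≤ (1 + 1 / δ) * (1 + δ * ‖z‖) := by
              have h4 : 1 / δ * (δ * ‖z‖) = ‖z‖ := by field_simp
              have h5 : 0 ≤ 1 / δ := by positivity
              have h6 : 0 ≤ δ * ‖z‖ := by positivity
              linarith
          _ ≤ _ := by
              gcongr
              linarith [Real.add_one_le_exp (δ * ‖z‖)]
      calc _ ≤ (1 + 1 / δ) * Real.exp (δ * ‖z‖) * Real.exp (-(δ * ‖z‖)) := by gcongr
        _ = 1 + 1 / δ := by rw [mul_assoc, ← Real.exp_add]; simp
    calc _ ≤ N * (1 + ‖z‖) * Real.exp (-(t * z.re)) * (T * Real.exp (ε₀ * ‖z‖)) := by gcongr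
      _ = N * T * (1 + ‖z‖) * (Real.exp (-(t * z.re)) * Real.exp (ε₀ * ‖z‖)) := by ring
      _ ≤ N * T * (1 + ‖z‖) * (Real.exp (-(t * c')) * Real.exp (-(δ * ‖z‖))) := by gcongr
      _ = N * T * ((1 + ‖z‖) * Real.exp (-(δ * ‖z‖))) * Real.exp (-(t * c')) := by ring
      _ ≤ N * T * (1 + 1 / δ) * Real.exp (-(t * c')) := by gcongr
      _ ≤ 1 / 2 := hsmall
  refine ⟨h1, ?_⟩
  calc ‖resolvent A (z ^ 2)‖ ≤ ‖z‖ * ‖resolvent A (z ^ 2)‖ :=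
        le_mul_of_one_le_left (norm_nonneg _) hz1
    _ ≤ N * (1 / ‖laplace (primitive K) z‖) := h2
    _ ≤ N * (T * Real.exp (ε₀ * ‖z‖)) := by gcongr
    _ ≤ N * (T * Real.exp (τ * ε * ‖z‖)) := by gcongr
    _ = _ := by ring

theorem exists_ultraLog_resolvent_bound (hK : LocallyIntegrableOn K (Ici 0)) {m : ℕ → ℝ}
    {τ : EReal} {α : ℝ} (hm : IsWeightSeq m) (hβ : 0 < β) (hα : 0 < α)
    (hΘ : ∀ t : ℝ, 0 ≤ t → ‖primitive K t‖ ≤ M * Real.exp (β * t)) (hP2 : CondP2 K)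
    (hgen : IsGenerator A K τ C)
    (hlow : (fun z : ℂ => 1 / ‖laplace (primitive K) z‖)
      =O[Bornology.cobounded ℂ ⊓ 𝓟 {z : ℂ | β < z.re}]
        fun z : ℂ => Real.exp (assocFun m (α * ‖z‖)))
    {τ₁ : ℝ} (hτ₁ : 0 < τ₁) (hτ : (τ₁ : EReal) < τ) :
    ∃ β' c : ℝ, 0 < β' ∧ 0 < c ∧ ∀ z ∈ ultraLog m α β' τ₁, z ^ 2 ∈ resolventSet A ∧
      ‖resolvent A (z ^ 2)‖ ≤ c * (Real.exp (assocFun m (α * ‖z‖)) / (1 + ‖z‖)) := by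
  obtain ⟨-, b, -, hb⟩ := hP2
  obtain ⟨T, hT, hTO⟩ := hlow.exists_pos
  obtain ⟨r₀, -, hr₀⟩ := (Filter.hasBasis_cobounded_norm.eventually_iff).1
    (eventually_inf_principal.1 hTO.bound)
  -- On the region `e^{-t Re z}` is at most `e^{-tβ'} e^{-(t/τ₁) M(α|z|)}`; taking `t > τ₁` leaves
  -- `e^{-δM}` after dividing by `|θ|`, and `M` outgrows the logarithm.
  obtain ⟨t, ht1, ht2⟩ := EReal.lt_iff_exists_real_btwn.1 hτ
  rw [EReal.coe_lt_coe_iff] at ht1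
  have ht0 : 0 < t := hτ₁.trans ht1
  have hδ : 0 < t / τ₁ - 1 := sub_pos.2 ((one_lt_div hτ₁).2 ht1)
  set δ := t / τ₁ - 1 with hδdef
  obtain ⟨Q, hQ0, hQ⟩ := exists_le_exp_assocFun hm hδ
  obtain ⟨N, hN0, hN⟩ := exists_resolvent_sq_bound hK hβ.le hΘ hgen (t := t) ⟨ht0.le, ht2⟩
  obtain ⟨β', hβ', hsmall⟩ := exists_ge_mul_exp_neg_le (N * T * (2 / α * Q))
    -- In order: range of the `O`-bound, tail estimate, nonvanishing of the transform of `K`, `|z| ≥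
    -- 1`, and `α|z| ≥ 1` for the logarithmic comparison.
    (max (max r₀ (β + 1)) (max (b + 1) (max 1 (1 / α)))) ht0
  simp only [max_le_iff] at hβ'
  obtain ⟨⟨hc1, hc2⟩, hc3, hc4, hc5⟩ := hβ'
  refine ⟨β', 2 * (N * T), by linarith, by positivity, fun z hz => ?_⟩
  have hz' : assocFun m (α * ‖z‖) / τ₁ + β' ≤ z.re := hz
  have hm0 : 0 ≤ assocFun m (α * ‖z‖) := assocFun_nonneg hm (by positivity)
  have hm1 : 0 ≤ assocFun m (α * ‖z‖) / τ₁ := by positivity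
  have hzβ : β' ≤ ‖z‖ := by linarith [Complex.re_le_norm z]
  have hz1 : 1 ≤ ‖z‖ := hc4.trans hzβ
  have hαz : 1 ≤ α * ‖z‖ := by rw [← div_le_iff₀' hα]; exact hc5.trans hzβ
  have hl : 1 / ‖laplace (primitive K) z‖ ≤ T * Real.exp (assocFun m (α * ‖z‖)) := by
    have := hr₀ (x := z) (hc1.trans hzβ) (show β < z.re by linarith)
    rwa [Real.norm_of_nonneg (by positivity), Real.norm_of_nonneg (Real.exp_pos _).le] at this
  -- The bound on `1 / ‖θ‖` does not exclude zeros, since `1 / 0 = 0`; (P2) does.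
  have hne : laplace (primitive K) z ≠ 0 := fun h0 => hb z (by linarith) <| by
    rw [laplace_eq_mul_laplace_primitive hK hΘ (by linarith), h0, mul_zero]
  obtain ⟨h1, h2⟩ := hN z (by linarith) hne <| by
    set a := assocFun m (α * ‖z‖)
    have e1 : Real.exp (-(t * z.re)) * Real.exp a
        ≤ Real.exp (-(t * β')) * Real.exp (-(δ * a)) := by
      rw [← Real.exp_add, ← Real.exp_add, Real.exp_le_exp, hδdef]
      have h3 := mul_le_mul_of_nonneg_left hz' ht0.le
      have h4 : t * (a / τ₁ + β') = t / τ₁ * a + t * β' := by ring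
      linarith
    have e2 : (1 + ‖z‖) * Real.exp (-(δ * a)) ≤ 2 / α * Q := by
      calc _ ≤ 2 / α * (α * ‖z‖) * Real.exp (-(δ * a)) := by
            gcongr
            rw [← mul_assoc, div_mul_cancel₀ _ hα.ne']
            linarith
        _ ≤ 2 / α * (Q * Real.exp (δ * a)) * Real.exp (-(δ * a)) := by
            have := hQ _ hαz
            gcongr ?_ * ?_ * ?_
        _ = 2 / α * Q * (Real.exp (δ * a) * Real.exp (-(δ * a))) := by ring
        _ = _ := by rw [← Real.exp_add]; simp
    calc _ ≤ N * (1 + ‖z‖) * Real.exp (-(t * z.re)) * (T * Real.exp a) := by gcongr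
      _ = N * T * (1 + ‖z‖) * (Real.exp (-(t * z.re)) * Real.exp a) := by ring
      _ ≤ N * T * (1 + ‖z‖) * (Real.exp (-(t * β')) * Real.exp (-(δ * a))) := by gcongr
      _ = N * T * ((1 + ‖z‖) * Real.exp (-(δ * a))) * Real.exp (-(t * β')) := by ring
      _ ≤ N * T * (2 / α * Q) * Real.exp (-(t * β')) := by gcongr
      _ ≤ 1 / 2 := hsmall
  refine ⟨h1, ?_⟩
  -- The factor `2` in the constant pays for `1 + |z| ≤ 2|z|`.
  rw [← mul_div_assoc, le_div_iff₀ (by positivity)]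
  calc _ ≤ ‖resolvent A (z ^ 2)‖ * (2 * ‖z‖) := by gcongr; linarith
    _ = 2 * (‖z‖ * ‖resolvent A (z ^ 2)‖) := by ring
    _ ≤ 2 * (N * (1 / ‖laplace (primitive K) z‖)) := by gcongr
    _ ≤ 2 * (N * (T * Real.exp (assocFun m (α * ‖z‖)))) := by gcongr
    _ = _ := by ring

end ConvCosine

/-! ### Both resolvent estimates, stated on the sets of squares -/

theorem theorem11 {E : Type*} [NormedAddCommGroup E] [NormedSpace ℂ E] [CompleteSpace E]
    (A : E →ₗ.[ℂ] E) (K : ℝ → ℂ) (hK : LocallyIntegrableOn K (Ici 0)) :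
    (∀ (τ : ℝ) (C : ℝ → E →L[ℂ] E) (M β : ℝ), 0 < τ → 0 < M → 0 < β →
      ConvCosine.CondP2 (ConvCosine.primitive K) →
      (∀ t : ℝ, 0 ≤ t → ‖ConvCosine.primitive K t‖ ≤ M * Real.exp (β * t)) →
      ConvCosine.IsGenerator A K (τ : EReal) C →
      (∀ ε : ℝ, 0 < ε → ∃ c T ε₀ : ℝ, 0 < c ∧ 0 < T ∧ 0 < ε₀ ∧ ε₀ < τ * ε ∧
        ∀ z ∈ ConvCosine.ouchi ε c, β < z.re →
          1 / ‖ConvCosine.laplace (ConvCosine.primitive K) z‖ ≤ T * Real.exp (ε₀ * ‖z‖)) →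
      ∀ ε : ℝ, 0 < ε → ∃ c k : ℝ, 0 < c ∧ 0 < k ∧
        ConvCosine.squares (ConvCosine.ouchi ε c) ⊆ ConvCosine.resolventSet A ∧
        ∀ z ∈ ConvCosine.ouchi ε c,
          ‖ConvCosine.resolvent A (z ^ 2)‖ ≤ k * Real.exp (τ * ε * ‖z‖)) ∧
    (∀ (m : ℕ → ℝ) (τ : EReal) (C : ℝ → E →L[ℂ] E) (M β α : ℝ), ConvCosine.IsWeightSeq m →
      0 < τ → 0 < M → 0 < β → 0 < α →
      (∀ t : ℝ, 0 ≤ t → ‖ConvCosine.primitive K t‖ ≤ M * Real.exp (β * t)) →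
      ConvCosine.CondP2 K →
      ¬ (K =ᵐ[volume.restrict (ConvCosine.timeInterval τ)] 0) →
      ConvCosine.IsGenerator A K τ C →
      ((fun z : ℂ => 1 / ‖ConvCosine.laplace (ConvCosine.primitive K) z‖)
        =O[Bornology.cobounded ℂ ⊓ 𝓟 {z : ℂ | β < z.re}]
          fun z : ℂ => Real.exp (ConvCosine.assocFun m (α * ‖z‖))) →
      ∀ τ₁ : ℝ, 0 < τ₁ → (τ₁ : EReal) < τ → ∃ β' c : ℝ, 0 < β' ∧ 0 < c ∧
        ConvCosine.squares (ConvCosine.ultraLog m α β' τ₁) ⊆ ConvCosine.resolventSet A ∧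
        ∀ z ∈ ConvCosine.squares (ConvCosine.ultraLog m α β' τ₁),
          ‖ConvCosine.resolvent A z‖ ≤
            c * (Real.exp (ConvCosine.assocFun m (α * Real.sqrt ‖z‖)) /
              (1 + Real.sqrt ‖z‖))) := by
  refine ⟨fun τ C M β _ _ hβ hP2 hΘ hgen hlow ε hε => ?_,
    fun m τ C M β α hm _ _ hβ hα hΘ hP2 _ hgen hlow τ₁ hτ₁ hτ => ?_⟩
  · obtain ⟨c, k, hc, hk, h⟩ := ConvCosine.exists_ouchi_resolvent_bound hK hβ hP2 hΘ hgen hε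
      (hlow ε hε)
    refine ⟨c, k, hc, hk, ?_, fun z hz => (h z hz).2⟩
    rintro _ ⟨z, hz, rfl⟩
    exact (h z hz).1
  · obtain ⟨β', c, hβ', hc, h⟩ :=
      ConvCosine.exists_ultraLog_resolvent_bound hK hm hβ hα hΘ hP2 hgen hlow hτ₁ hτ
    refine ⟨β', c, hβ', hc, ?_, ?_⟩
    · rintro _ ⟨z, hz, rfl⟩
      exact (h z hz).1
    · rintro _ ⟨z, hz, rfl⟩
      -- The bound involves only `√‖z²‖ = ‖z‖`, so the choice of square root does not matter.
      simpa only [norm_pow, Real.sqrt_sq (norm_nonneg z)] using (h z hz).2
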